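/- Let $d,m,L,n\ge 1$ and let $\phi:\mathbb R\to\mathbb R$ be twice differentiable with $|\phi'|\le 1$ and $|\phi''|\le\beta_\phi$. For parameters $\theta=(W^{(1)},\dots,W^{(L)},v)$ with $W^{(1)}\in\mathbb R^{m\times d}$, $W^{(l)}\in\mathbb R^{m\times m}$ for $2\le l\le L$, $v\in\mathbb R^m$, where all the rows $W^{(l)}_i$ are nonzero, the weight-normalized network is $$\alpha^{(0)}(x)=x,\qquad \alpha^{(l)}_i(x)=\phi\Big(\tfrac1{\sqrt m}\tfrac{(W^{(l)}_i)^\top}{\|W^{(l)}_i\|_2}\alpha^{(l-1)}(x)\Big)\ (1\le i\le m,\ 1\le l\le L),\qquad f(\theta;x)=v^\top\alpha^{(L)}(x).$$ Let $\|\bar W\|=\min_{i\in[m],\,l\in[L]}\|W^{(l)}_i\|_2$ denote the minimum weight vector norm of $\theta$. Let $(x_i,y_i)_{i=1}^n$ be data in $\mathbb R^d\times\mathbb R$ with $\|x_i\|_2=1$ for all $i$ and $\frac1n\sum_{i=1}^n y_i^2\le Y$, and let $\mathcal L(\theta)=\frac1n\sum_{i=1}^n(y_i-f(\theta;x_i))^2$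 be the empirical square loss. Let $v_0\in\mathbb R^m$ with $\|v_0\|_2=1$ and let $\rho_1>0$. There is a constant $C>0$, depending only on $\beta_\phi$ and $Y$, such that in every such situation there is a function $\theta\mapsto\beta_\theta\in\mathbb R$ for which the following holds. For every $\theta$ with nonzero rows and $\|v-v_0\|_2\le\rho_1$, the loss $\mathcal L$ is differentiable at $\theta$, and for every $\theta'$ with nonzero rows and $\|v'-v_0\|_2\le\rho_1$, $$\mathcal L(\theta')\le\mathcal L(\theta)+\langle\theta'-\theta,\nabla\mathcal L(\theta)\rangle+\frac{\beta_\theta}{2}\|\theta'-\theta\|_2^2 ,$$ where $$\beta_\theta\le C\,L^4\big(1+L^2\max\{|\phi(0)|,|\phi(0)|^2\}\,m\big)^2(1+\rho_1)^2\Big(1+\frac1{\min\{\|\bar W\|,\|\bar W\|^2\}}\Big),$$ and, if moreover $\phi(0)=0$, the same $\beta_\theta$ also satisfies $$\beta_\theta\le C\Big(1+\frac{L^3(1+\rho_1)^3}{\sqrt m\,\min\{\|\bar W\|,\|\bar W\|^2\}}\Big).$$ -/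

import Mathlib

noncomputable section

namespace WeightNorm

/-- Width of layer `l`: the input layer has width `d`, every hidden layer has width `m`. -/
def width (d m : ℕ) : ℕ → ℕ
  | 0 => d
  | _ + 1 => m

/-- Index set of the scalar parameters of a network with input dimension `d`, `L` hidden layers of
width `m` and a linear output layer. The index `Sum.inl ⟨l, i, j⟩` is the `(i, j)` entry of the
weight matrix that maps layer `l` to layer `l + 1` (so `l` is counted from `0`), and `Sum.inr i` is
the `i`-th entry of the output vector. -/
abbrev ParamIndex (d m L : ℕ) : Type :=
  (Σ l : Fin L, Fin m × Fin (width d m l)) ⊕ Fin m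

/-- The parameter space, with its Euclidean norm; its dimension is `d m + (L - 1) m ^ 2 + m`
if `1 ≤ L`. -/
abbrev Params (d m L : ℕ) : Type := EuclideanSpace ℝ (ParamIndex d m L)

variable {d m L : ℕ}

/-- The weight vector of neuron `i` in layer `l + 1`, i.e. the `i`-th row of the weight matrix. -/
def weightRow (θ : Params d m L) (l : Fin L) (i : Fin m) : EuclideanSpace ℝ (Fin (width d m l)) :=
  WithLp.toLp 2 fun j => θ (Sum.inl ⟨l, i, j⟩)

/-- The vector of the linear output layer. -/
def outputVec (θ : Params d m L) : EuclideanSpace ℝ (Fin m) :=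
  WithLp.toLp 2 fun i => θ (Sum.inr i)

/-- The parameters at which weight normalization is defined: no weight vector vanishes. -/
def Admissible (θ : Params d m L) : Prop :=
  ∀ (l : Fin L) (i : Fin m), weightRow θ l i ≠ 0

/-- The smallest Euclidean norm of a weight vector (a minimum over a finite set, which is nonempty
as soon as `0 < L` and `0 < m`). -/
def minWeightNorm (θ : Params d m L) : ℝ :=
  ⨅ p : Fin L × Fin m, ‖weightRow θ p.1 p.2‖

/-- The vector of activations of layer `l ≤ L` of the weight-normalized network on input `x`. -/
def activation (φ : ℝ → ℝ) (θ : Params d m L) (x : EuclideanSpace ℝ (Fin d)) :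
    (l : ℕ) → l ≤ L → EuclideanSpace ℝ (Fin (width d m l))
  | 0, _ => x
  | l + 1, hl => WithLp.toLp 2 fun i : Fin m =>
      φ (1 / √(m : ℝ) * (inner ℝ (weightRow θ ⟨l, hl⟩ i)
        (activation φ θ x l (Nat.le_of_succ_le hl)) / ‖weightRow θ ⟨l, hl⟩ i‖))

/-- The predictor `f(θ; x)`: the output vector paired with the activations of layer `L ≥ 1` (for
`L = 0` there is no network, and the value is set to `0`). -/
def predictor (φ : ℝ → ℝ) (θ : Params d m L) (x : EuclideanSpace ℝ (Fin d)) : ℝ :=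
  match L, θ with
  | 0, _ => 0
  | L + 1, θ => inner ℝ (outputVec θ) (activation φ θ x (L + 1) le_rfl)

/-- The empirical square loss. -/
def empiricalLoss {n : ℕ} (φ : ℝ → ℝ) (x : Fin n → EuclideanSpace ℝ (Fin d)) (y : Fin n → ℝ)
    (θ : Params d m L) : ℝ :=
  1 / (n : ℝ) * ∑ i, (y i - predictor φ θ (x i)) ^ 2

end WeightNorm

end

/-! Everything follows from one second-order expansion of the loss at a fixed `θ`: a continuous
linear `D` with `|𝓛(θ') - 𝓛(θ) - D(θ' - θ)| ≤ K ‖θ' - θ‖²`, where `K` depends on `θ` only through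
its smallest row norm and a bound on `‖v‖`. Such an expansion yields differentiability, identifies
`D` with the gradient, and gives the inequality with `β_θ = 2K`.

No Hessian is bounded along the segment from `θ` to `θ'`, since rows may vanish there and the
normalization is singular. Instead `w ↦ w/‖w‖` is expanded at `w ≠ 0` with a remainder at most `3‖w'
- w‖²/‖w‖²` for every `w'` (`norm_unitVec_sub_sub_le`), so only the row norms of the base point
enter.

First-order differences and second-order remainders are then propagated through the layers. Because
of the factor `1/√m` and `|φ'| ≤ 1`, a layer is 1-Lipschitz in its input: an inherited error passes
on with factor 1, and each layer only adds a new error, so growth is polynomial in `L`. The new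
error comes from moving the rows and keeps a factor `1/√m`, because the squared row displacements
sum to at most `‖θ' - θ‖²` (`norm_le_of_coord_le`). Activations are at most `a = 1 + L√m|φ(0)|`. The
output pairing and the square are expanded algebraically, and `smoothnessScale` collects the result;
the two bounds on `β_θ` differ only in how `a` is estimated. -/

noncomputable section

namespace WeightNorm

/-! ### Second-order expansion of the normalization map -/

section Normalization

variable {H : Type*} [NormedAddCommGroup H] [InnerProductSpace ℝ H]

/-- The weight vector `w` scaled to unit length (and `0` if `w = 0`). -/
def unitVec (w : H) : H := ‖w‖⁻¹ • w

/-- The derivative of `unitVec` at `w ≠ 0`. -/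
def unitVecDeriv (w : H) : H →L[ℝ] H :=
  ‖w‖⁻¹ • (ContinuousLinearMap.id ℝ H - (innerSL ℝ (unitVec w)).smulRight (unitVec w))

lemma norm_unitVec_le (w : H) : ‖unitVec w‖ ≤ 1 := by
  rw [unitVec, norm_smul, norm_inv, norm_norm]
  exact inv_mul_le_one

lemma norm_smul_unitVec (w : H) : ‖w‖ • unitVec w = w := by
  by_cases h : w = 0
  · simp [h, unitVec]
  · rw [unitVec, smul_smul, mul_inv_cancel₀ (norm_ne_zero_iff.2 h), one_smul]

/-- Only `w` must be nonzero: with the default value `unitVec 0 = 0`, the identity survives at `w' =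
0`. This is what makes the later estimates global in `w'`. -/
lemma unitVec_sub (w w' : H) (hw : w ≠ 0) :
    unitVec w' - unitVec w = ‖w‖⁻¹ • (w' - w) + (‖w‖⁻¹ * (‖w‖ - ‖w'‖)) • unitVec w' := by
  have h : ‖w‖⁻¹ * ‖w‖ = 1 := inv_mul_cancel₀ (norm_ne_zero_iff.2 hw)
  have h' : (‖w‖⁻¹ * ‖w'‖) • unitVec w' = ‖w‖⁻¹ • w' := by
    rw [mul_smul, norm_smul_unitVec]
  rw [mul_sub, sub_smul, h, h', one_smul, smul_sub, unitVec, unitVec]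
  abel

lemma norm_unitVec_sub_le (w w' : H) (hw : w ≠ 0) :
    ‖unitVec w' - unitVec w‖ ≤ 2 / ‖w‖ * ‖w' - w‖ := by
  have hp : 0 < ‖w‖ := norm_pos_iff.2 hw
  have h1 : ‖‖w‖⁻¹ • (w' - w)‖ = ‖w‖⁻¹ * ‖w' - w‖ := by
    rw [norm_smul, norm_inv, norm_norm]
  have h2 : ‖(‖w‖⁻¹ * (‖w‖ - ‖w'‖)) • unitVec w'‖ ≤ ‖w‖⁻¹ * ‖w' - w‖ * 1 := by
    rw [norm_smul, norm_mul, norm_inv, norm_norm, Real.norm_eq_abs]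
    gcongr
    · rw [abs_sub_comm]
      exact abs_norm_sub_norm_le _ _
    · exact norm_unitVec_le _
  calc _ ≤ _ := by rw [unitVec_sub w w' hw]; exact norm_add_le _ _
    _ ≤ ‖w‖⁻¹ * ‖w' - w‖ + ‖w‖⁻¹ * ‖w' - w‖ * 1 := add_le_add h1.le h2
    _ = _ := by ring

/-- The remainder equals the Cauchy–Schwarz defect `(‖w‖‖w'‖ - ⟪w, w'⟫) / ‖w‖`, and twice that
defect's numerator is `‖w' - w‖² - (‖w'‖ - ‖w‖)²`. -/
lemma abs_norm_sub_norm_sub_inner_le (w w' : H) (hw : w ≠ 0) :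
    |‖w'‖ - ‖w‖ - inner ℝ (unitVec w) (w' - w)| ≤ ‖w' - w‖ ^ 2 / ‖w‖ := by
  have hp : 0 < ‖w‖ := norm_pos_iff.2 hw
  have hu : inner ℝ (unitVec w) (w' - w) = ‖w‖⁻¹ * inner ℝ w w' - ‖w‖ := by
    rw [unitVec, inner_smul_left, inner_sub_right, real_inner_self_eq_norm_sq]
    simp only [conj_trivial]
    field_simp
  have hi : inner ℝ w w' ≤ ‖w‖ * ‖w'‖ := real_inner_le_norm w w'
  have hs := norm_sub_sq_real w' w
  rw [real_inner_comm] at hs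
  have e : ‖w'‖ - ‖w‖ - inner ℝ (unitVec w) (w' - w)
      = (‖w‖ * ‖w'‖ - inner ℝ w w') / ‖w‖ := by
    rw [hu]
    field_simp
    ring
  rw [e, abs_of_nonneg (div_nonneg (by linarith) hp.le)]
  gcongr
  nlinarith [sq_nonneg (‖w'‖ - ‖w‖)]

/-- The remainder splits into a product of two first-order differences, contributing 2 to the
constant, and the second-order remainder of the norm, contributing 1. -/
lemma norm_unitVec_sub_sub_le (w w' : H) (hw : w ≠ 0) :
    ‖unitVec w' - unitVec w - unitVecDeriv w (w' - w)‖ ≤ 3 / ‖w‖ ^ 2 * ‖w' - w‖ ^ 2 := by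
  have hp : 0 < ‖w‖ := norm_pos_iff.2 hw
  have e : unitVec w' - unitVec w - unitVecDeriv w (w' - w)
      = (‖w‖⁻¹ * (‖w‖ - ‖w'‖)) • (unitVec w' - unitVec w)
        - (‖w‖⁻¹ * (‖w'‖ - ‖w‖ - inner ℝ (unitVec w) (w' - w))) • unitVec w := by
    have : unitVecDeriv w (w' - w)
        = ‖w‖⁻¹ • (w' - w) - (‖w‖⁻¹ * inner ℝ (unitVec w) (w' - w)) • unitVec w := by
      simp [unitVecDeriv, smul_sub, smul_smul]
    rw [this, unitVec_sub w w' hw, ← unitVec_sub w w' hw]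
    -- Only the difference on the left is expanded; the one on the right stays as a first-order
    -- factor.
    nth_rewrite 1 [unitVec_sub w w' hw]
    module
  have h1 : ‖(‖w‖⁻¹ * (‖w‖ - ‖w'‖)) • (unitVec w' - unitVec w)‖
      ≤ ‖w‖⁻¹ * ‖w' - w‖ * (2 / ‖w‖ * ‖w' - w‖) := by
    rw [norm_smul, norm_mul, norm_inv, norm_norm, Real.norm_eq_abs]
    gcongr
    · rw [abs_sub_comm]
      exact abs_norm_sub_norm_le _ _
    · exact norm_unitVec_sub_le _ _ hw
  have h2 : ‖(‖w‖⁻¹ * (‖w'‖ - ‖w‖ - inner ℝ (unitVec w) (w' - w))) • unitVec w‖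
      ≤ ‖w‖⁻¹ * (‖w' - w‖ ^ 2 / ‖w‖) * 1 := by
    rw [norm_smul, norm_mul, norm_inv, norm_norm, Real.norm_eq_abs]
    gcongr
    · exact abs_norm_sub_norm_sub_inner_le _ _ hw
    · exact norm_unitVec_le _
  rw [e]
  refine (norm_sub_le _ _).trans ((add_le_add h1 h2).trans (le_of_eq ?_))
  field_simp
  ring

end Normalization

/-! ### First- and second-order estimates for the activation function -/

section Scalar

variable {φ : ℝ → ℝ} {B : ℝ}

lemma abs_sub_le_of_deriv_le_one (hφ : Differentiable ℝ φ) (h1 : ∀ t, |deriv φ t| ≤ 1) (s t : ℝ) :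
    |φ t - φ s| ≤ |t - s| := by
  have := Convex.norm_image_sub_le_of_norm_deriv_le (f := φ) (C := 1) (s := Set.univ)
    (fun x _ => hφ x) (fun x _ => h1 x) convex_univ (Set.mem_univ s) (Set.mem_univ t)
  simpa using this

/-- The mean value inequality is used twice: for `deriv φ`, then for `r ↦ φ r - deriv φ s * r`
between `s` and `t`. No continuity of the second derivative is needed, at the price of `B` instead
of `B / 2`. -/
lemma abs_sub_sub_deriv_mul_le (hφ : Differentiable ℝ φ) (hφ' : Differentiable ℝ (deriv φ))
    (h2 : ∀ t, |deriv (deriv φ) t| ≤ B) (s t : ℝ) :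
    |φ t - φ s - deriv φ s * (t - s)| ≤ B * (t - s) ^ 2 := by
  have hd : ∀ r, HasDerivAt (fun r => φ r - deriv φ s * r) (deriv φ r - deriv φ s) r := fun r => by
    have h := (hφ r).hasDerivAt.sub ((hasDerivAt_id r).const_mul (deriv φ s))
    rwa [mul_one] at h
  have hB : 0 ≤ B := (abs_nonneg _).trans (h2 0)
  have hbd : ∀ r ∈ Set.uIcc s t, ‖deriv φ r - deriv φ s‖ ≤ B * |t - s| := fun r hr => by
    have h := Convex.norm_image_sub_le_of_norm_deriv_le (f := deriv φ) (C := B) (s := Set.univ)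
      (fun x _ => hφ' x) (fun x _ => h2 x) convex_univ (Set.mem_univ s) (Set.mem_univ r)
    refine h.trans (mul_le_mul_of_nonneg_left ?_ hB)
    exact Set.abs_sub_left_of_mem_uIcc hr
  have h := Convex.norm_image_sub_le_of_norm_hasDerivWithin_le (s := Set.uIcc s t)
    (fun r _ => (hd r).hasDerivWithinAt) hbd (convex_uIcc s t) Set.left_mem_uIcc Set.right_mem_uIcc
  calc |φ t - φ s - deriv φ s * (t - s)|
      = ‖φ t - deriv φ s * t - (φ s - deriv φ s * s)‖ := by
        rw [Real.norm_eq_abs]; congr 1; ring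
    _ ≤ B * |t - s| * ‖t - s‖ := h
    _ = B * (t - s) ^ 2 := by rw [Real.norm_eq_abs, mul_assoc, abs_mul_abs_self, sq]

end Scalar

/-! ### Perturbation of a single layer -/

section Layer

/-- Minkowski's inequality for a constant vector plus a multiple of `e`. The `m` equal coordinates
absorb the factor `1/√m`, while the row-dependent part retains it; this is the source of the `1/√m`
in the final bound. -/
lemma norm_le_of_coord_le {m : ℕ} (x : EuclideanSpace ℝ (Fin m)) (e : Fin m → ℝ) {q c E : ℝ}
    (hq : 0 ≤ q) (hc : 0 ≤ c) (hE : 0 ≤ E) (he : ∑ i, e i ^ 2 ≤ E ^ 2)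
    (h : ∀ i, |x i| ≤ (q + c * e i) / √(m : ℝ)) : ‖x‖ ≤ q + c * E / √(m : ℝ) := by
  let y : EuclideanSpace ℝ (Fin m) := WithLp.toLp 2 fun _ => q / √(m : ℝ)
  let z : EuclideanSpace ℝ (Fin m) := WithLp.toLp 2 e
  have hy : ‖y‖ ≤ q := by
    refine abs_le_of_sq_le_sq' ?_ hq |>.2
    rw [EuclideanSpace.norm_sq_eq]
    simp only [y, Real.norm_eq_abs, sq_abs, Finset.sum_const, Finset.card_univ, Fintype.card_fin,
      nsmul_eq_mul, div_pow, Real.sq_sqrt (Nat.cast_nonneg m)]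
    rcases Nat.eq_zero_or_pos m with rfl | hm
    · simp [sq_nonneg]
    · rw [mul_div_cancel₀]
      positivity
  have hz : ‖z‖ ≤ E := by
    refine abs_le_of_sq_le_sq' ?_ hE |>.2
    rw [EuclideanSpace.norm_sq_eq]
    simpa [z] using he
  have hx : ‖x‖ ≤ ‖y + (c / √(m : ℝ)) • z‖ := by
    rw [EuclideanSpace.norm_eq, EuclideanSpace.norm_eq]
    refine Real.sqrt_le_sqrt (Finset.sum_le_sum fun i _ => ?_)
    have hi : ‖x i‖ ≤ (y + (c / √(m : ℝ)) • z) i := by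
      refine (h i).trans (le_of_eq ?_)
      simp [y, z]
      ring
    exact pow_le_pow_left₀ (norm_nonneg _) (hi.trans (le_abs_self _)) 2
  calc ‖x‖ ≤ ‖y‖ + ‖(c / √(m : ℝ)) • z‖ := hx.trans (norm_add_le _ _)
    _ ≤ q + c / √(m : ℝ) * E := by
        rw [norm_smul, Real.norm_of_nonneg (by positivity)]
        gcongr
    _ = _ := by ring

variable {m : ℕ} {H : Type*} [NormedAddCommGroup H] [InnerProductSpace ℝ H] {φ : ℝ → ℝ} {B : ℝ}

/-- The input of the activation function at the neuron with weight vector `w`. -/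
def preact (m : ℕ) (w a : H) : ℝ := 1 / √(m : ℝ) * (inner ℝ w a / ‖w‖)

/-- A weight-normalized layer with weight vectors `W`, applied to `a`. -/
def layer (φ : ℝ → ℝ) (W : Fin m → H) (a : H) : EuclideanSpace ℝ (Fin m) :=
  WithLp.toLp 2 fun i => φ (preact m (W i) a)

lemma preact_eq (w a : H) : preact m w a = inner ℝ (unitVec w) a / √(m : ℝ) := by
  rw [preact, unitVec, inner_smul_left]
  simp only [conj_trivial]
  ring

lemma norm_layer_le (hφ : Differentiable ℝ φ) (h1 : ∀ t, |deriv φ t| ≤ 1) (W : Fin m → H) (a : H) :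
    ‖layer φ W a‖ ≤ ‖a‖ + √(m : ℝ) * |φ 0| := by
  rcases Nat.eq_zero_or_pos m with rfl | hm
  · have : layer φ W a = 0 := Subsingleton.elim _ _
    rw [this, norm_zero]
    positivity
  have hs : 0 < √(m : ℝ) := by positivity
  refine (norm_le_of_coord_le (layer φ W a) 0 (c := 0) (E := 0)
    (q := ‖a‖ + √(m : ℝ) * |φ 0|) (by positivity) le_rfl le_rfl (by simp) fun i => ?_).trans
    (by simp)
  have hz : |preact m (W i) a| ≤ ‖a‖ / √(m : ℝ) := by
    rw [preact_eq, abs_div, abs_of_pos hs]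
    gcongr
    refine (abs_real_inner_le_norm _ _).trans ?_
    exact (mul_le_mul_of_nonneg_right (norm_unitVec_le _) (norm_nonneg _)).trans_eq (one_mul _)
  have h := abs_sub_le_of_deriv_le_one hφ h1 0 (preact m (W i) a)
  rw [sub_zero] at h
  calc |φ (preact m (W i) a)| ≤ |φ (preact m (W i) a) - φ 0| + |φ 0| := by
        simpa using abs_add_le (φ (preact m (W i) a) - φ 0) (φ 0)
    _ ≤ ‖a‖ / √(m : ℝ) + |φ 0| := by gcongr; exact h.trans hz
    _ = _ := by
        simp only [zero_mul, add_zero]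
        field_simp

lemma abs_preact_sub_le {w₀ A q : ℝ} (hw₀ : 0 < w₀) {w w' a a' : H} (hw : w₀ ≤ ‖w‖)
    (ha : ‖a'‖ ≤ A) (hq : ‖a' - a‖ ≤ q) :
    |preact m w' a' - preact m w a| ≤ (q + 2 * A / w₀ * ‖w' - w‖) / √(m : ℝ) := by
  have hw0 : w ≠ 0 := norm_pos_iff.1 (hw₀.trans_le hw)
  have e : preact m w' a' - preact m w a
      = (inner ℝ (unitVec w) (a' - a) + inner ℝ (unitVec w' - unitVec w) a') / √(m : ℝ) := by
    rw [preact_eq, preact_eq, inner_sub_right, inner_sub_left]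
    ring
  rw [e, abs_div, abs_of_nonneg (Real.sqrt_nonneg (m : ℝ))]
  gcongr
  refine (abs_add_le _ _).trans (add_le_add ?_ ?_)
  · calc _ ≤ ‖unitVec w‖ * ‖a' - a‖ := abs_real_inner_le_norm _ _
      _ ≤ 1 * q := by gcongr; exact norm_unitVec_le _
      _ = q := one_mul q
  · calc _ ≤ ‖unitVec w' - unitVec w‖ * ‖a'‖ := abs_real_inner_le_norm _ _
      _ ≤ (2 / ‖w‖ * ‖w' - w‖) * A := by gcongr; exact norm_unitVec_sub_le _ _ hw0
      _ ≤ (2 / w₀ * ‖w' - w‖) * A := by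
          have : 0 ≤ A := (norm_nonneg _).trans ha
          gcongr
      _ = _ := by ring

lemma norm_layer_sub_le (hφ : Differentiable ℝ φ) (h1 : ∀ t, |deriv φ t| ≤ 1) {w₀ A q E : ℝ}
    (hw₀ : 0 < w₀) {W W' : Fin m → H} {a a' : H} (hw : ∀ i, w₀ ≤ ‖W i‖) (ha : ‖a'‖ ≤ A)
    (hq : ‖a' - a‖ ≤ q) (hE : 0 ≤ E) (hE' : ∑ i, ‖W' i - W i‖ ^ 2 ≤ E ^ 2) :
    ‖layer φ W' a' - layer φ W a‖ ≤ q + 2 * A / w₀ * E / √(m : ℝ) := by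
  have hA : 0 ≤ A := (norm_nonneg _).trans ha
  refine norm_le_of_coord_le _ (fun i => ‖W' i - W i‖) ((norm_nonneg _).trans hq) (by positivity)
    hE hE' fun i => ?_
  exact (abs_sub_le_of_deriv_le_one hφ h1 _ _).trans (abs_preact_sub_le hw₀ (hw i) ha hq)

/-- The derivative of the `i`-th pre-activation in the direction `(δ, b)`. -/
def preactDeriv (m : ℕ) (w a δ b : H) : ℝ :=
  (inner ℝ (unitVec w) b + inner ℝ a (unitVecDeriv w δ)) / √(m : ℝ)

/-- Bilinearity in (unit vector, input) leaves three errors: the inherited remainder of the input,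
the cross term of the two differences, and the remainder of the normalization. -/
lemma abs_preact_sub_sub_le {w₀ A q r : ℝ} (hw₀ : 0 < w₀) {w w' a a' b : H} (hw : w₀ ≤ ‖w‖)
    (ha : ‖a‖ ≤ A) (hq : ‖a' - a‖ ≤ q) (hr : ‖a' - a - b‖ ≤ r) :
    |preact m w' a' - preact m w a - preactDeriv m w a (w' - w) b|
      ≤ (r + 2 / w₀ * ‖w' - w‖ * q + 3 * A / w₀ ^ 2 * ‖w' - w‖ ^ 2) / √(m : ℝ) := by
  have hw0 : w ≠ 0 := norm_pos_iff.1 (hw₀.trans_le hw)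
  have hA : 0 ≤ A := (norm_nonneg _).trans ha
  have e : preact m w' a' - preact m w a - preactDeriv m w a (w' - w) b
      = (inner ℝ (unitVec w) (a' - a - b) + inner ℝ (unitVec w' - unitVec w) (a' - a)
        + inner ℝ (unitVec w' - unitVec w - unitVecDeriv w (w' - w)) a) / √(m : ℝ) := by
    rw [preact_eq, preact_eq, preactDeriv, real_inner_comm _ a]
    simp only [inner_sub_right, inner_sub_left]
    ring
  rw [e, abs_div, abs_of_nonneg (Real.sqrt_nonneg (m : ℝ))]
  gcongr
  refine (abs_add_le _ _).trans (add_le_add ((abs_add_le _ _).trans (add_le_add ?_ ?_)) ?_)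
  · calc _ ≤ ‖unitVec w‖ * ‖a' - a - b‖ := abs_real_inner_le_norm _ _
      _ ≤ 1 * r := by gcongr; exact norm_unitVec_le _
      _ = r := one_mul r
  · calc _ ≤ ‖unitVec w' - unitVec w‖ * ‖a' - a‖ := abs_real_inner_le_norm _ _
      _ ≤ (2 / ‖w‖ * ‖w' - w‖) * q := by gcongr; exact norm_unitVec_sub_le _ _ hw0
      _ ≤ (2 / w₀ * ‖w' - w‖) * q := by
          have : 0 ≤ q := (norm_nonneg _).trans hq
          gcongr
  · calc _ ≤ _ * ‖a‖ := abs_real_inner_le_norm _ _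
      _ ≤ (3 / ‖w‖ ^ 2 * ‖w' - w‖ ^ 2) * A := by gcongr; exact norm_unitVec_sub_sub_le _ _ hw0
      _ ≤ (3 / w₀ ^ 2 * ‖w' - w‖ ^ 2) * A := by gcongr
      _ = _ := by ring

/-- The derivative of `layer φ W a` in the direction `(δ, b)`. -/
def layerDeriv (φ : ℝ → ℝ) (W : Fin m → H) (a : H) (δ : Fin m → H) (b : H) :
    EuclideanSpace ℝ (Fin m) :=
  WithLp.toLp 2 fun i => deriv φ (preact m (W i) a) * preactDeriv m (W i) a (δ i) b

/-- The inherited remainder `r` reappears with coefficient exactly 1, so it does not compound with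
depth; all other terms are quadratic in `q` and `E`. -/
lemma norm_layer_sub_sub_le (hφ : Differentiable ℝ φ) (hφ' : Differentiable ℝ (deriv φ))
    (h1 : ∀ t, |deriv φ t| ≤ 1) (h2 : ∀ t, |deriv (deriv φ) t| ≤ B) {w₀ A q r E : ℝ}
    (hw₀ : 0 < w₀) {W W' : Fin m → H} {a a' b : H} (hw : ∀ i, w₀ ≤ ‖W i‖) (ha : ‖a‖ ≤ A)
    (ha' : ‖a'‖ ≤ A) (hq : ‖a' - a‖ ≤ q) (hr : ‖a' - a - b‖ ≤ r) (hE : 0 ≤ E)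
    (hE' : ∑ i, ‖W' i - W i‖ ^ 2 ≤ E ^ 2) :
    ‖layer φ W' a' - layer φ W a - layerDeriv φ W a (fun i => W' i - W i) b‖
      ≤ r + 2 * B * q ^ 2 / √(m : ℝ) + (2 / w₀ * q + 3 * A / w₀ ^ 2 * E
          + 8 * B * A ^ 2 / w₀ ^ 2 * E / √(m : ℝ)) * E / √(m : ℝ) := by
  have hA : 0 ≤ A := (norm_nonneg _).trans ha
  have hB : 0 ≤ B := (abs_nonneg _).trans (h2 0)
  have hq0 : 0 ≤ q := (norm_nonneg _).trans hq
  have hr0 : 0 ≤ r := (norm_nonneg _).trans hr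
  refine norm_le_of_coord_le _ (fun i => ‖W' i - W i‖) (by positivity) (by positivity)
    hE hE' fun i => ?_
  have hs : 0 ≤ √(m : ℝ) := Real.sqrt_nonneg _
  have heE : ‖W' i - W i‖ ≤ E := by
    refine abs_le_of_sq_le_sq' (le_trans ?_ hE') hE |>.2
    exact Finset.single_le_sum (f := fun i => ‖W' i - W i‖ ^ 2) (fun _ _ => sq_nonneg _)
      (Finset.mem_univ i)
  set z := preact m (W i) a
  set z' := preact m (W' i) a'
  set p := preactDeriv m (W i) a (W' i - W i) b
  set e := ‖W' i - W i‖ with he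
  have he0 : 0 ≤ e := norm_nonneg _
  have hz : |z' - z| ≤ (q + 2 * A / w₀ * e) / √(m : ℝ) := abs_preact_sub_le hw₀ (hw i) ha' hq
  have hp : |z' - z - p| ≤ (r + 2 / w₀ * e * q + 3 * A / w₀ ^ 2 * e ^ 2) / √(m : ℝ) :=
    abs_preact_sub_sub_le hw₀ (hw i) ha hq hr
  have ht : |φ z' - φ z - deriv φ z * (z' - z)| ≤ B * (z' - z) ^ 2 :=
    abs_sub_sub_deriv_mul_le hφ hφ' h2 z z'
  -- Replacing one factor by the global `E` makes the coordinate bound linear in `e`, the form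
  -- `norm_le_of_coord_le` requires.
  have e2 : e ^ 2 ≤ E * e := by rw [sq]; gcongr
  have hz2 : (z' - z) ^ 2 ≤ (2 * q ^ 2 + 8 * A ^ 2 / w₀ ^ 2 * (E * e)) / √(m : ℝ) / √(m : ℝ) := by
    rw [← sq_abs]
    calc |z' - z| ^ 2 ≤ ((q + 2 * A / w₀ * e) / √(m : ℝ)) ^ 2 := by gcongr
      _ = (q + 2 * A / w₀ * e) ^ 2 / √(m : ℝ) / √(m : ℝ) := by rw [div_pow, sq √(m : ℝ), div_div]
      _ ≤ (2 * q ^ 2 + 8 * A ^ 2 / w₀ ^ 2 * e ^ 2) / √(m : ℝ) / √(m : ℝ) := by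
          gcongr
          have : 8 * A ^ 2 / w₀ ^ 2 * e ^ 2 = 2 * (2 * A / w₀ * e) ^ 2 := by ring
          rw [this]
          nlinarith [sq_nonneg (q - 2 * A / w₀ * e)]
      _ ≤ _ := by gcongr
  have hsplit : φ z' - φ z - deriv φ z * p
      = (φ z' - φ z - deriv φ z * (z' - z)) + deriv φ z * (z' - z - p) := by ring
  change |φ z' - φ z - deriv φ z * p| ≤ _
  rw [hsplit]
  calc _ ≤ B * (z' - z) ^ 2 + 1 * |z' - z - p| := by
        refine (abs_add_le _ _).trans (add_le_add ht ?_)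
        rw [abs_mul]
        gcongr
        exact h1 z
    _ ≤ B * ((2 * q ^ 2 + 8 * A ^ 2 / w₀ ^ 2 * (E * e)) / √(m : ℝ) / √(m : ℝ))
        + 1 * ((r + 2 / w₀ * e * q + 3 * A / w₀ ^ 2 * (E * e)) / √(m : ℝ)) := by
        gcongr
        refine hp.trans ?_
        gcongr
    _ = _ := by ring

end Layer

/-! ### Parameter norms and propagation through the layers -/

variable {d m L : ℕ}

lemma norm_weightRow_sq (θ : Params d m L) (l : Fin L) (i : Fin m) :
    ‖weightRow θ l i‖ ^ 2 = ∑ j, θ (Sum.inl ⟨l, i, j⟩) ^ 2 := by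
  simp [EuclideanSpace.norm_sq_eq, weightRow]

lemma norm_outputVec_sq (θ : Params d m L) : ‖outputVec θ‖ ^ 2 = ∑ i, θ (Sum.inr i) ^ 2 := by
  simp [EuclideanSpace.norm_sq_eq, outputVec]

lemma norm_sq_eq_sum (θ : Params d m L) :
    ‖θ‖ ^ 2 = ∑ l, ∑ i, ‖weightRow θ l i‖ ^ 2 + ‖outputVec θ‖ ^ 2 := by
  simp only [norm_weightRow_sq, norm_outputVec_sq]
  simp only [EuclideanSpace.norm_sq_eq, Real.norm_eq_abs, sq_abs, Fintype.sum_sum_type, Fintype.sum_sigma, Fintype.sum_prod_type]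

lemma sum_norm_weightRow_sq_le (θ : Params d m L) (l : Fin L) :
    ∑ i, ‖weightRow θ l i‖ ^ 2 ≤ ‖θ‖ ^ 2 := by
  rw [norm_sq_eq_sum]
  have := Finset.single_le_sum (f := fun l => ∑ i, ‖weightRow θ l i‖ ^ 2)
    (fun _ _ => by positivity) (Finset.mem_univ l)
  nlinarith [sq_nonneg ‖outputVec θ‖]

lemma norm_outputVec_le (θ : Params d m L) : ‖outputVec θ‖ ≤ ‖θ‖ := by
  refine abs_le_of_sq_le_sq' ?_ (norm_nonneg _) |>.2
  rw [norm_sq_eq_sum]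
  have : 0 ≤ ∑ l, ∑ i, ‖weightRow θ l i‖ ^ 2 := by positivity
  linarith

/-- `weightRow` as a continuous linear map. -/
def weightRowCLM (l : Fin L) (i : Fin m) :
    Params d m L →L[ℝ] EuclideanSpace ℝ (Fin (width d m l)) :=
  LinearMap.toContinuousLinearMap
    { toFun := fun θ => weightRow θ l i
      map_add' := fun _ _ => rfl
      map_smul' := fun _ _ => rfl }

/-- `outputVec` as a continuous linear map. -/
def outputVecCLM : Params d m L →L[ℝ] EuclideanSpace ℝ (Fin m) :=
  LinearMap.toContinuousLinearMap
    { toFun := outputVec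
      map_add' := fun _ _ => rfl
      map_smul' := fun _ _ => rfl }

lemma minWeightNorm_le (θ : Params d m L) (l : Fin L) (i : Fin m) :
    minWeightNorm θ ≤ ‖weightRow θ l i‖ :=
  ciInf_le (f := fun p : Fin L × Fin m => ‖weightRow θ p.1 p.2‖) (Set.finite_range _).bddBelow (l, i)

lemma minWeightNorm_pos (hm : 0 < m) (hL : 0 < L) {θ : Params d m L} (hθ : Admissible θ) :
    0 < minWeightNorm θ := by
  have : Nonempty (Fin L × Fin m) := ⟨(⟨0, hL⟩, ⟨0, hm⟩)⟩
  obtain ⟨p, hp⟩ := exists_eq_ciInf_of_finite (f := fun p : Fin L × Fin m => ‖weightRow θ p.1 p.2‖)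
  rw [minWeightNorm, ← hp]
  exact norm_pos_iff.2 (hθ _ _)

variable {φ : ℝ → ℝ} {B : ℝ}

/-- A bound on the norm of every activation vector on inputs of norm `1`. -/
def activationBound (φ : ℝ → ℝ) (m L : ℕ) : ℝ := 1 + L * √(m : ℝ) * |φ 0|

lemma one_le_activationBound (φ : ℝ → ℝ) (m L : ℕ) : 1 ≤ activationBound φ m L := by
  rw [activationBound]
  have : 0 ≤ L * √(m : ℝ) * |φ 0| := by positivity
  linarith

lemma norm_activation_le (hφ : Differentiable ℝ φ) (h1 : ∀ t, |deriv φ t| ≤ 1) (θ : Params d m L)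
    {x : EuclideanSpace ℝ (Fin d)} (hx : ‖x‖ = 1) (l : ℕ) (hl : l ≤ L) :
    ‖activation φ θ x l hl‖ ≤ activationBound φ m L := by
  suffices h : ‖activation φ θ x l hl‖ ≤ 1 + l * √(m : ℝ) * |φ 0| by
    refine h.trans ?_
    rw [activationBound]
    gcongr
  induction l with
  | zero => exact (le_of_eq hx).trans (by simp)
  | succ l ih =>
    refine (norm_layer_le hφ h1 (weightRow θ ⟨l, hl⟩) _).trans ?_
    have := ih (Nat.le_of_succ_le hl)
    push_cast
    linarith

/-- Each layer adds the same amount to the inherited difference, hence linear growth in `l`. -/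
lemma norm_activation_sub_le (hφ : Differentiable ℝ φ) (h1 : ∀ t, |deriv φ t| ≤ 1)
    {x : EuclideanSpace ℝ (Fin d)} (hx : ‖x‖ = 1) {θ : Params d m L} {w₀ : ℝ} (hw₀ : 0 < w₀)
    (hw : ∀ l i, w₀ ≤ ‖weightRow θ l i‖) (θ' : Params d m L) (l : ℕ) (hl : l ≤ L) :
    ‖activation φ θ' x l hl - activation φ θ x l hl‖
      ≤ l * (2 * activationBound φ m L / w₀ / √(m : ℝ)) * ‖θ' - θ‖ := by
  induction l with
  | zero =>
    change ‖x - x‖ ≤ _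
    simp
  | succ l ih =>
    refine (norm_layer_sub_le hφ h1 hw₀ (W := weightRow θ ⟨l, hl⟩) (W' := weightRow θ' ⟨l, hl⟩)
      (hw _) (norm_activation_le hφ h1 θ' hx l _) (ih (Nat.le_of_succ_le hl)) (norm_nonneg (θ' - θ))
      (sum_norm_weightRow_sq_le (θ' - θ) ⟨l, hl⟩)).trans (le_of_eq ?_)
    push_cast
    ring

/-- The derivative of a layer with respect to the parameters. -/
lemma exists_clm_layerDeriv {P H : Type*} [NormedAddCommGroup P] [NormedSpace ℝ P]
    [NormedAddCommGroup H] [InnerProductSpace ℝ H] (φ : ℝ → ℝ) (W : Fin m → H) (a : H)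
    (R : Fin m → P →L[ℝ] H) (D : P →L[ℝ] H) :
    ∃ D' : P →L[ℝ] EuclideanSpace ℝ (Fin m),
      ∀ δ, D' δ = layerDeriv φ W a (fun i => R i δ) (D δ) := by
  refine ⟨(EuclideanSpace.equiv (Fin m) ℝ).symm.toContinuousLinearMap ∘L
    ContinuousLinearMap.pi fun i => (deriv φ (preact m (W i) a) * (√(m : ℝ))⁻¹) •
      (innerSL ℝ (unitVec (W i)) ∘L D + innerSL ℝ a ∘L unitVecDeriv (W i) ∘L R i), fun δ => ?_⟩
  ext i
  simp [layerDeriv, preactDeriv]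
  ring

/-- The derivative is built by the chain rule along the induction. The activation difference grows
linearly in depth, so its square costs `L ^ 2` per layer, and summing over the layers supplies the
factor `l`. -/
lemma exists_norm_activation_sub_sub_le (hm : 0 < m) (hφ : Differentiable ℝ φ)
    (hφ' : Differentiable ℝ (deriv φ)) (h1 : ∀ t, |deriv φ t| ≤ 1)
    (h2 : ∀ t, |deriv (deriv φ) t| ≤ B) {x : EuclideanSpace ℝ (Fin d)} (hx : ‖x‖ = 1)
    {θ : Params d m L} {w₀ : ℝ} (hw₀ : 0 < w₀) (hw : ∀ l i, w₀ ≤ ‖weightRow θ l i‖)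
    (l : ℕ) (hl : l ≤ L) :
    ∃ D : Params d m L →L[ℝ] EuclideanSpace ℝ (Fin (width d m l)), ∀ θ' : Params d m L,
      ‖activation φ θ' x l hl - activation φ θ x l hl - D (θ' - θ)‖
        ≤ l * ((16 * B + 7) * L ^ 2 * activationBound φ m L ^ 2 / (√(m : ℝ) * w₀ ^ 2))
          * ‖θ' - θ‖ ^ 2 := by
  induction l with
  | zero => exact ⟨0, fun θ' => by
      change ‖x - x - 0‖ ≤ _
      simp⟩
  | succ l ih =>
    obtain ⟨D, hD⟩ := ih (Nat.le_of_succ_le hl)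
    obtain ⟨D', hD'⟩ := exists_clm_layerDeriv φ (weightRow θ ⟨l, hl⟩)
      (activation φ θ x l (Nat.le_of_succ_le hl)) (weightRowCLM ⟨l, hl⟩) D
    refine ⟨D', fun θ' => ?_⟩
    have h := norm_layer_sub_sub_le hφ hφ' h1 h2 hw₀ (W := weightRow θ ⟨l, hl⟩)
      (W' := weightRow θ' ⟨l, hl⟩) (hw _) (norm_activation_le hφ h1 θ hx l _)
      (norm_activation_le hφ h1 θ' hx l _)
      (norm_activation_sub_le hφ h1 hx hw₀ hw θ' l (Nat.le_of_succ_le hl)) (hD θ')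
      (norm_nonneg (θ' - θ)) (sum_norm_weightRow_sq_le (θ' - θ) ⟨l, hl⟩)
    change ‖layer φ (weightRow θ' ⟨l, hl⟩) _ - layer φ (weightRow θ ⟨l, hl⟩) _ - D' (θ' - θ)‖ ≤ _
    rw [hD']
    refine h.trans ?_
    have hB : 0 ≤ B := (abs_nonneg _).trans (h2 0)
    set A := activationBound φ m L
    set E := ‖θ' - θ‖
    have hA : 1 ≤ A := one_le_activationBound φ m L
    have hA0 : 0 < A := by linarith
    have hm1 : (1 : ℝ) ≤ m := by exact_mod_cast hm
    have hs : 1 ≤ √(m : ℝ) := Real.one_le_sqrt.2 hm1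
    have hlL : (l : ℝ) ≤ L := by exact_mod_cast Nat.le_of_succ_le hl
    have hL1 : (1 : ℝ) ≤ L := by exact_mod_cast (Nat.succ_pos l).trans_le hl
    set s := √(m : ℝ)
    have hs0 : 0 < s := by linarith
    have hE : 0 ≤ E := norm_nonneg _
    have hL2 : (1 : ℝ) ≤ (L : ℝ) ^ 2 := one_le_pow₀ hL1
    have hLL : (L : ℝ) ≤ (L : ℝ) ^ 2 := by nlinarith
    have hAA : A ≤ A ^ 2 := by nlinarith
    set Q := A ^ 2 * E ^ 2 / (s * w₀ ^ 2) with hQ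
    have hQ0 : 0 ≤ Q := by positivity
    have t1 : 2 * B * (l * (2 * A / w₀ / s) * E) ^ 2 / s ≤ 8 * B * L ^ 2 * Q := by
      calc _ = 8 * B * l ^ 2 * Q * (1 / s ^ 2) := by rw [hQ]; field_simp; ring
        _ ≤ 8 * B * L ^ 2 * Q * 1 := by
          gcongr
          exact div_le_one_of_le₀ (one_le_pow₀ hs) (by positivity)
        _ = _ := by ring
    have t2 : 2 / w₀ * (l * (2 * A / w₀ / s) * E) * E / s ≤ 4 * L ^ 2 * Q := by
      calc _ = 4 * l * (A * E ^ 2 / (s * w₀ ^ 2)) * (1 / s) := by field_simp; ring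
        _ ≤ 4 * L ^ 2 * (A ^ 2 * E ^ 2 / (s * w₀ ^ 2)) * 1 := by
          gcongr
          · exact hlL.trans hLL
          · exact div_le_one_of_le₀ hs (by positivity)
        _ = _ := by rw [mul_one]
    have t3 : 3 * A / w₀ ^ 2 * E * E / s ≤ 3 * L ^ 2 * Q := by
      calc _ = 3 * 1 * (A * E ^ 2 / (s * w₀ ^ 2)) := by field_simp
        _ ≤ 3 * L ^ 2 * (A ^ 2 * E ^ 2 / (s * w₀ ^ 2)) := by gcongr
    have t4 : 8 * B * A ^ 2 / w₀ ^ 2 * E / s * E / s ≤ 8 * B * L ^ 2 * Q := by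
      calc _ = 8 * B * 1 * Q * (1 / s) := by rw [hQ]; field_simp
        _ ≤ 8 * B * L ^ 2 * Q * 1 := by
          gcongr
          exact div_le_one_of_le₀ hs (by positivity)
        _ = _ := by ring
    -- The constant `16 * B + 7` is the sum `8B + 4 + 3 + 8B` of the four new errors `t1`–`t4`.
    have hfin : ((l + 1 : ℕ) : ℝ) * ((16 * B + 7) * L ^ 2 * A ^ 2 / (s * w₀ ^ 2)) * E ^ 2
        = l * ((16 * B + 7) * L ^ 2 * A ^ 2 / (s * w₀ ^ 2)) * E ^ 2
          + (8 * B * L ^ 2 * Q + (4 * L ^ 2 * Q + 3 * L ^ 2 * Q + 8 * B * L ^ 2 * Q)) := by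
      rw [hQ]
      push_cast
      ring
    have hsum : (2 / w₀ * (l * (2 * A / w₀ / s) * E) + 3 * A / w₀ ^ 2 * E
          + 8 * B * A ^ 2 / w₀ ^ 2 * E / s) * E / s
        = 2 / w₀ * (l * (2 * A / w₀ / s) * E) * E / s + 3 * A / w₀ ^ 2 * E * E / s
          + 8 * B * A ^ 2 / w₀ ^ 2 * E / s * E / s := by ring
    rw [hfin, hsum]
    linarith

/-! ### Expansion of the network output -/

section Predictor

variable {d m L : ℕ} {φ : ℝ → ℝ} {B : ℝ}

lemma abs_predictor_le (hL : 0 < L) (hφ : Differentiable ℝ φ) (h1 : ∀ t, |deriv φ t| ≤ 1)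
    (θ : Params d m L) {x : EuclideanSpace ℝ (Fin d)} (hx : ‖x‖ = 1) :
    |predictor φ θ x| ≤ ‖outputVec θ‖ * activationBound φ m L := by
  obtain ⟨k, rfl⟩ : ∃ k, L = k + 1 := ⟨L - 1, by lia⟩
  exact (abs_real_inner_le_norm _ _).trans
    (mul_le_mul_of_nonneg_left (norm_activation_le hφ h1 θ hx (k + 1) le_rfl) (norm_nonneg _))

lemma abs_predictor_sub_le (hL : 0 < L) (hφ : Differentiable ℝ φ) (h1 : ∀ t, |deriv φ t| ≤ 1)
    {x : EuclideanSpace ℝ (Fin d)} (hx : ‖x‖ = 1) {θ : Params d m L} {w₀ : ℝ} (hw₀ : 0 < w₀)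
    (hw : ∀ l i, w₀ ≤ ‖weightRow θ l i‖) (θ' : Params d m L) :
    |predictor φ θ' x - predictor φ θ x|
      ≤ (activationBound φ m L
        + ‖outputVec θ‖ * (L * (2 * activationBound φ m L / w₀ / √(m : ℝ)))) * ‖θ' - θ‖ := by
  obtain ⟨k, rfl⟩ : ∃ k, L = k + 1 := ⟨L - 1, by lia⟩
  let a : EuclideanSpace ℝ (Fin m) := activation φ θ x (k + 1) le_rfl
  let a' : EuclideanSpace ℝ (Fin m) := activation φ θ' x (k + 1) le_rfl
  have ha' : ‖a'‖ ≤ activationBound φ m (k + 1) := norm_activation_le hφ h1 θ' hx _ _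
  have haa : ‖a' - a‖ ≤ _ := norm_activation_sub_le hφ h1 hx hw₀ hw θ' (k + 1) le_rfl
  -- The product difference is split so that the activations at `θ'` meet only `v' - v`; the only
  -- output vector whose size enters is the one at the base point.
  have e : predictor φ θ' x - predictor φ θ x
      = inner ℝ (outputVec (θ' - θ)) a' + inner ℝ (outputVec θ) (a' - a) := by
    have hv : outputVec (θ' - θ) = outputVec θ' - outputVec θ := rfl
    rw [hv, inner_sub_left, inner_sub_right]
    change inner ℝ (outputVec θ') a' - inner ℝ (outputVec θ) a = _
    ring
  rw [e]
  calc _ ≤ ‖outputVec (θ' - θ)‖ * ‖a'‖ + ‖outputVec θ‖ * ‖a' - a‖ :=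
        (abs_add_le _ _).trans
          (add_le_add (abs_real_inner_le_norm _ _) (abs_real_inner_le_norm _ _))
    _ ≤ ‖θ' - θ‖ * activationBound φ m (k + 1) + ‖outputVec θ‖ *
        ((k + 1 : ℕ) * (2 * activationBound φ m (k + 1) / w₀ / √(m : ℝ)) * ‖θ' - θ‖) := by
        gcongr
        exact norm_outputVec_le _
    _ = _ := by ring

lemma exists_abs_predictor_sub_sub_le (hm : 0 < m) (hL : 0 < L) (hφ : Differentiable ℝ φ)
    (hφ' : Differentiable ℝ (deriv φ)) (h1 : ∀ t, |deriv φ t| ≤ 1)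
    (h2 : ∀ t, |deriv (deriv φ) t| ≤ B) {x : EuclideanSpace ℝ (Fin d)} (hx : ‖x‖ = 1)
    {θ : Params d m L} {w₀ : ℝ} (hw₀ : 0 < w₀) (hw : ∀ l i, w₀ ≤ ‖weightRow θ l i‖) :
    ∃ D : Params d m L →L[ℝ] ℝ, ∀ θ' : Params d m L,
      |predictor φ θ' x - predictor φ θ x - D (θ' - θ)|
        ≤ (L * (2 * activationBound φ m L / w₀ / √(m : ℝ)) + ‖outputVec θ‖ *
          (L * ((16 * B + 7) * L ^ 2 * activationBound φ m L ^ 2 / (√(m : ℝ) * w₀ ^ 2))))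
          * ‖θ' - θ‖ ^ 2 := by
  obtain ⟨k, rfl⟩ : ∃ k, L = k + 1 := ⟨L - 1, by lia⟩
  obtain ⟨D, hD⟩ : ∃ D : Params d m (k + 1) →L[ℝ] EuclideanSpace ℝ (Fin m), _ :=
    exists_norm_activation_sub_sub_le hm hφ hφ' h1 h2 hx hw₀ hw (k + 1) le_rfl
  let a : EuclideanSpace ℝ (Fin m) := activation φ θ x (k + 1) le_rfl
  let T : Params d m (k + 1) →L[ℝ] ℝ :=
    (innerSL ℝ (outputVec θ)).comp D + (innerSL ℝ a).comp outputVecCLM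
  refine ⟨T, fun θ' => ?_⟩
  let a' : EuclideanSpace ℝ (Fin m) := activation φ θ' x (k + 1) le_rfl
  have haa : ‖a' - a‖ ≤ _ := norm_activation_sub_le hφ h1 hx hw₀ hw θ' (k + 1) le_rfl
  have hR : ‖a' - a - D (θ' - θ)‖ ≤ _ := hD θ'
  have e : predictor φ θ' x - predictor φ θ x - T (θ' - θ)
      = inner ℝ (outputVec (θ' - θ)) (a' - a) + inner ℝ (outputVec θ) (a' - a - D (θ' - θ)) := by
    have hv : outputVec (θ' - θ) = outputVec θ' - outputVec θ := rfl
    have hs : T (θ' - θ)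
        = inner ℝ (outputVec θ) (D (θ' - θ)) + inner ℝ (outputVec (θ' - θ)) a := by
      rw [real_inner_comm a]
      rfl
    rw [hs, hv]
    simp only [inner_sub_left, inner_sub_right]
    change inner ℝ (outputVec θ') a' - inner ℝ (outputVec θ) a - _ = _
    ring
  rw [e]
  calc _ ≤ ‖outputVec (θ' - θ)‖ * ‖a' - a‖ + ‖outputVec θ‖ * ‖a' - a - D (θ' - θ)‖ :=
        (abs_add_le _ _).trans
          (add_le_add (abs_real_inner_le_norm _ _) (abs_real_inner_le_norm _ _))
    _ ≤ ‖θ' - θ‖ * ((k + 1 : ℕ) * (2 * activationBound φ m (k + 1) / w₀ / √(m : ℝ)) * ‖θ' - θ‖)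
        + ‖outputVec θ‖ * ((k + 1 : ℕ) * ((16 * B + 7) * (k + 1 : ℕ) ^ 2
          * activationBound φ m (k + 1) ^ 2 / (√(m : ℝ) * w₀ ^ 2)) * ‖θ' - θ‖ ^ 2) := by
        gcongr
        exact norm_outputVec_le _
    _ = _ := by ring

end Predictor

/-! ### From the output to the loss and its gradient -/

section SquareLoss

variable {P : Type*} [NormedAddCommGroup P]

lemma exists_abs_squareLoss_sub_sub_le [NormedSpace ℝ P] {n : ℕ} (hn : 0 < n) {f : Fin n → P → ℝ}
    {y : Fin n → ℝ} {Y F G K : ℝ} (hy : 1 / (n : ℝ) * ∑ i, y i ^ 2 ≤ Y) {θ : P}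
    (hK0 : 0 ≤ K) (hF : ∀ i, |f i θ| ≤ F) (hG : ∀ i θ', |f i θ' - f i θ| ≤ G * ‖θ' - θ‖)
    (hK : ∀ i, ∃ D : P →L[ℝ] ℝ, ∀ θ', |f i θ' - f i θ - D (θ' - θ)| ≤ K * ‖θ' - θ‖ ^ 2) :
    ∃ D : P →L[ℝ] ℝ, ∀ θ', |1 / (n : ℝ) * ∑ i, (y i - f i θ') ^ 2
        - 1 / (n : ℝ) * ∑ i, (y i - f i θ) ^ 2 - D (θ' - θ)|
      ≤ (G ^ 2 + 2 * (F + (1 + Y)) * K) * ‖θ' - θ‖ ^ 2 := by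
  choose D hD using hK
  have hn' : (0 : ℝ) < n := by exact_mod_cast hn
  refine ⟨(1 / (n : ℝ)) • ∑ i, (-2 * (y i - f i θ)) • D i, fun θ' => ?_⟩
  -- The square is expanded exactly: its remainder is the squared first-order difference of the
  -- output minus twice the residual times the output's own remainder.
  have e : 1 / (n : ℝ) * ∑ i, (y i - f i θ') ^ 2 - 1 / (n : ℝ) * ∑ i, (y i - f i θ) ^ 2
        - ((1 / (n : ℝ)) • ∑ i, (-2 * (y i - f i θ)) • D i) (θ' - θ)
      = 1 / (n : ℝ) * ∑ i, ((f i θ' - f i θ) ^ 2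
        - 2 * (y i - f i θ) * (f i θ' - f i θ - D i (θ' - θ))) := by
    simp only [smul_apply, sum_apply, smul_eq_mul]
    rw [← mul_sub, ← mul_sub, ← Finset.sum_sub_distrib, ← Finset.sum_sub_distrib]
    congr 1
    exact Finset.sum_congr rfl fun i _ => by ring
  have hi : ∀ i, |(f i θ' - f i θ) ^ 2 - 2 * (y i - f i θ) * (f i θ' - f i θ - D i (θ' - θ))|
      ≤ (G ^ 2 + 2 * (F + (1 + y i ^ 2)) * K) * ‖θ' - θ‖ ^ 2 := fun i => by
    have h3 : |y i - f i θ| ≤ F + (1 + y i ^ 2) := by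
      refine (abs_sub _ _).trans ?_
      -- After averaging, this turns the second-moment bound into the `1 + Y` of the statement.
      have : |y i| ≤ 1 + y i ^ 2 := by nlinarith [sq_abs (y i), sq_nonneg (|y i| - 1)]
      linarith [hF i]
    calc _ ≤ |f i θ' - f i θ| ^ 2 + 2 * |y i - f i θ| * |f i θ' - f i θ - D i (θ' - θ)| := by
          refine (abs_sub _ _).trans (le_of_eq ?_)
          simp [abs_mul]
      _ ≤ (G * ‖θ' - θ‖) ^ 2 + 2 * (F + (1 + y i ^ 2)) * (K * ‖θ' - θ‖ ^ 2) := by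
          gcongr
          · exact hG i θ'
          · linarith [(abs_nonneg _).trans h3]
          · exact hD i θ'
      _ = _ := by ring
  rw [e, abs_mul, abs_of_nonneg (by positivity : 0 ≤ 1 / (n : ℝ))]
  calc _ ≤ 1 / (n : ℝ) * ∑ i, (G ^ 2 + 2 * (F + (1 + y i ^ 2)) * K) * ‖θ' - θ‖ ^ 2 := by
        gcongr
        exact (Finset.abs_sum_le_sum_abs _ _).trans (Finset.sum_le_sum fun i _ => hi i)
    _ = (G ^ 2 + 2 * (F + (1 + 1 / (n : ℝ) * ∑ i, y i ^ 2)) * K) * ‖θ' - θ‖ ^ 2 := by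
        rw [← Finset.sum_mul, Finset.sum_add_distrib, ← Finset.sum_mul, ← Finset.mul_sum,
          Finset.sum_add_distrib, Finset.sum_add_distrib]
        simp only [Finset.sum_const, Finset.card_univ, Fintype.card_fin, nsmul_eq_mul]
        field_simp
    _ ≤ _ := by gcongr

lemma hasFDerivAt_of_abs_sub_sub_le [NormedSpace ℝ P] {f : P → ℝ} {θ : P} {D : P →L[ℝ] ℝ} {K : ℝ}
    (h : ∀ θ', |f θ' - f θ - D (θ' - θ)| ≤ K * ‖θ' - θ‖ ^ 2) : HasFDerivAt f D θ := by
  refine .of_isLittleO ?_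
  have hO : (fun θ' => f θ' - f θ - D (θ' - θ)) =O[nhds θ] fun θ' => ‖θ' - θ‖ ^ 2 :=
    .of_bound K (.of_forall fun θ' => by simpa using h θ')
  exact hO.trans_isLittleO (Asymptotics.isLittleO_pow_sub_sub θ one_lt_two)

lemma le_add_inner_gradient_of_abs_sub_sub_le [InnerProductSpace ℝ P] [CompleteSpace P] {f : P → ℝ}
    {θ : P} {D : P →L[ℝ] ℝ} {K : ℝ} (h : ∀ θ', |f θ' - f θ - D (θ' - θ)| ≤ K * ‖θ' - θ‖ ^ 2)
    (θ' : P) : f θ' ≤ f θ + inner ℝ (θ' - θ) (gradient f θ) + K * ‖θ' - θ‖ ^ 2 := by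
  have hg : inner ℝ (θ' - θ) (gradient f θ) = D (θ' - θ) := by
    rw [real_inner_comm, gradient, (hasFDerivAt_of_abs_sub_sub_le h).fderiv,
      InnerProductSpace.toDual_symm_apply]
  rw [hg]
  linarith [(abs_le.1 (h θ')).2]

end SquareLoss

/-! ### Bookkeeping of the constants -/

section Constants

/-- The size of the second-order term, up to a constant factor; `a` bounds the activations and `w`
bounds the weight vectors from below. -/
def smoothnessScale (m L : ℕ) (a ρ w : ℝ) : ℝ :=
  a ^ 2 + (1 + ρ) ^ 2 * a ^ 3 * L ^ 3 / (√(m : ℝ) * min w (w ^ 2))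

variable {m L : ℕ} {a ρ w B Y v : ℝ}

/-- The left side is the loss constant `G ^ 2 + 2 * (F + (1 + Y)) * K` with the predictor's bounds
inserted. Both `1 / w` and `1 / w ^ 2` occur, so the common denominator uses the minimum of `w` and
`w ^ 2`. -/
lemma le_smoothnessScale (hm : 0 < m) (hL : 0 < L) (ha : 1 ≤ a) (hρ : 0 ≤ ρ) (hw : 0 < w)
    (hB : 0 ≤ B) (hY : 0 ≤ Y) (hv : 0 ≤ v) (hvρ : v ≤ 1 + ρ) :
    (a + v * (L * (2 * a / w / √(m : ℝ)))) ^ 2 + 2 * (v * a + (1 + Y)) *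
        (L * (2 * a / w / √(m : ℝ)) + v *
          (L * ((16 * B + 7) * L ^ 2 * a ^ 2 / (√(m : ℝ) * w ^ 2))))
      ≤ (10 + 2 * (2 + Y) * (16 * B + 9)) * smoothnessScale m L a ρ w := by
  have hs : 1 ≤ √(m : ℝ) := Real.one_le_sqrt.2 (by exact_mod_cast hm)
  have hL1 : (1 : ℝ) ≤ L := by exact_mod_cast hL
  set s := √(m : ℝ)
  set μ := min w (w ^ 2) with hμ
  have hs0 : 0 < s := by linarith
  have hμ0 : 0 < μ := lt_min hw (by positivity)
  have hμ1 : μ ≤ w := min_le_left _ _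
  have hμ2 : μ ≤ w ^ 2 := min_le_right _ _
  set T := L ^ 3 * a ^ 2 / (s * μ) with hT
  have hT0 : 0 ≤ T := by positivity
  set r := 1 + ρ with hr
  have hr1 : 1 ≤ r := by linarith
  have hscale : smoothnessScale m L a ρ w = a ^ 2 + r ^ 2 * a * T := by
    rw [smoothnessScale, hT]; ring
  have hra : 1 ≤ r * a := one_le_mul_of_one_le_of_one_le hr1 ha
  have h1 : L * (2 * a / w / s) ≤ 2 * T := by
    calc L * (2 * a / w / s) = 2 * ((L : ℝ) ^ 1 * a ^ 1 / (s * w)) := by field_simp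
      _ ≤ 2 * (L ^ 3 * a ^ 2 / (s * μ)) := by gcongr <;> first | assumption | norm_num
  have h2 : L * ((16 * B + 7) * L ^ 2 * a ^ 2 / (s * w ^ 2)) ≤ (16 * B + 7) * T := by
    calc _ = (16 * B + 7) * (L ^ 3 * a ^ 2 / (s * w ^ 2)) := by ring
      _ ≤ (16 * B + 7) * (L ^ 3 * a ^ 2 / (s * μ)) := by gcongr
  have h3 : (L * (2 * a / w / s)) ^ 2 ≤ 4 * T := by
    calc _ = 4 * (L ^ 2 * a ^ 2 / (s ^ 2 * w ^ 2)) := by field_simp; ring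
      _ ≤ 4 * (L ^ 3 * a ^ 2 / (s ^ 1 * μ)) := by gcongr <;> first | assumption | norm_num
      _ = 4 * T := by rw [pow_one]
  have h4 : (a + v * (L * (2 * a / w / s))) ^ 2 ≤ 2 * a ^ 2 + 8 * (r ^ 2 * a * T) := by
    calc _ ≤ 2 * a ^ 2 + 2 * (v ^ 2 * (L * (2 * a / w / s)) ^ 2) := by
          nlinarith [sq_nonneg (a - v * (L * (2 * a / w / s)))]
      _ ≤ 2 * a ^ 2 + 2 * (r ^ 2 * (4 * T)) := by gcongr
      _ ≤ 2 * a ^ 2 + 8 * (r ^ 2 * a * T) := by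
          have : r ^ 2 * 1 * T ≤ r ^ 2 * a * T := by gcongr
          linarith
  have h5 : L * (2 * a / w / s) + v * (L * ((16 * B + 7) * L ^ 2 * a ^ 2 / (s * w ^ 2)))
      ≤ (16 * B + 9) * (r * T) := by
    calc _ ≤ 2 * T + r * ((16 * B + 7) * T) := by gcongr
      _ ≤ _ := by nlinarith
  have h6 : 2 * (v * a + (1 + Y)) ≤ 2 * (2 + Y) * (r * a) := by
    have : v * a ≤ r * a := by gcongr
    nlinarith
  rw [hscale]
  calc _ ≤ 2 * a ^ 2 + 8 * (r ^ 2 * a * T)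
        + 2 * (2 + Y) * (r * a) * ((16 * B + 9) * (r * T)) := by gcongr
    _ = 2 * a ^ 2 + (8 + 2 * (2 + Y) * (16 * B + 9)) * (r ^ 2 * a * T) := by ring
    _ ≤ (10 + 2 * (2 + Y) * (16 * B + 9)) * a ^ 2
        + (10 + 2 * (2 + Y) * (16 * B + 9)) * (r ^ 2 * a * T) := by
        gcongr
        · have : 0 ≤ 2 * (2 + Y) * (16 * B + 9) := by positivity
          linarith
        · norm_num
    _ = _ := by ring

lemma smoothnessScale_le_of_bias (hm : 0 < m) (hL : 0 < L) (φ : ℝ → ℝ) (hρ : 0 ≤ ρ) (hw : 0 < w) :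
    smoothnessScale m L (activationBound φ m L) ρ w
      ≤ 2 * ((L : ℝ) ^ 4 * (1 + (L : ℝ) ^ 2 * max |φ 0| (|φ 0| ^ 2) * m) ^ 2
        * (1 + ρ) ^ 2 * (1 + 1 / min w (w ^ 2))) := by
  have hm1 : (1 : ℝ) ≤ m := by exact_mod_cast hm
  have hs : 1 ≤ √(m : ℝ) := Real.one_le_sqrt.2 hm1
  have hss : √(m : ℝ) ^ 2 = m := Real.sq_sqrt (by positivity)
  have hL1 : (1 : ℝ) ≤ L := by exact_mod_cast hL
  have ha := one_le_activationBound φ m L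
  set a := activationBound φ m L with ha_def
  set s := √(m : ℝ)
  set b := |φ 0|
  have hb : 0 ≤ b := abs_nonneg _
  set M := 1 + (L : ℝ) ^ 2 * max b (b ^ 2) * m
  set μ := min w (w ^ 2)
  have hμ0 : 0 < μ := lt_min hw (by positivity)
  have hMb : 1 + (L : ℝ) ^ 2 * b ^ 2 * m ≤ M := by
    dsimp only [M]; gcongr; exact le_max_right _ _
  have hM1 : 1 ≤ M := le_trans (by linarith [show 0 ≤ (L : ℝ) ^ 2 * b ^ 2 * m by positivity]) hMb
  have haM : a ≤ M := by
    have h1 : s ≤ m := by nlinarith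
    have h2 : (L : ℝ) ≤ L ^ 2 := by nlinarith
    calc a = 1 + L * b * s := by rw [ha_def, activationBound]; ring
      _ ≤ 1 + L ^ 2 * max b (b ^ 2) * m := by gcongr; exact le_max_left _ _
  -- From `(1 + t)² ≤ 2 (1 + t²)`. As `a ^ 2` is of order `M`, the cube `a ^ 3` costs only `M ^ 2`.
  have haM2 : a ^ 2 ≤ 2 * M := by
    have : a ^ 2 ≤ 2 * (1 + (L : ℝ) ^ 2 * b ^ 2 * m) := by
      have h : a = 1 + L * s * b := rfl
      rw [h, ← hss]
      nlinarith [sq_nonneg (1 - L * s * b)]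
    linarith
  have haM3 : a ^ 3 ≤ 2 * M ^ 2 := by nlinarith
  have hr : 1 ≤ (1 + ρ) ^ 2 := one_le_pow₀ (by linarith)
  have hL4 : 1 ≤ (L : ℝ) ^ 4 := one_le_pow₀ hL1
  calc _ = a ^ 2 + (1 + ρ) ^ 2 * a ^ 3 * L ^ 3 / (s * μ) := rfl
    _ ≤ 2 * M ^ 2 + (1 + ρ) ^ 2 * (2 * M ^ 2) * L ^ 4 / (1 * μ) := by
        gcongr
        · nlinarith
        norm_num
    _ ≤ 2 * (L ^ 4 * M ^ 2 * (1 + ρ) ^ 2)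
        + (1 + ρ) ^ 2 * (2 * M ^ 2) * L ^ 4 / (1 * μ) := by
        gcongr
        calc M ^ 2 = 1 * M ^ 2 * 1 := by ring
          _ ≤ L ^ 4 * M ^ 2 * (1 + ρ) ^ 2 := by gcongr
    _ = _ := by ring

lemma smoothnessScale_le_of_apply_zero {φ : ℝ → ℝ} (hφ0 : φ 0 = 0) (hρ : 0 ≤ ρ) (hw : 0 < w) :
    smoothnessScale m L (activationBound φ m L) ρ w
      ≤ 1 + (L : ℝ) ^ 3 * (1 + ρ) ^ 3 / (√(m : ℝ) * min w (w ^ 2)) := by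
  have ha : activationBound φ m L = 1 := by simp [activationBound, hφ0]
  have hμ0 : 0 < min w (w ^ 2) := lt_min hw (by positivity)
  rw [smoothnessScale, ha, one_pow, one_pow, mul_one, mul_comm]
  gcongr
  · linarith
  · norm_num

end Constants

end WeightNorm

end

/-! ### The main theorem -/

theorem mainTheorem6 (βφ Y : ℝ) :
    ∃ C : ℝ, 0 < C ∧
      ∀ (d m L n : ℕ), 0 < m → 0 < L → 0 < n →
      ∀ φ : ℝ → ℝ, Differentiable ℝ φ → Differentiable ℝ (deriv φ) →
        (∀ t, |deriv φ t| ≤ 1) → (∀ t, |deriv (deriv φ) t| ≤ βφ) →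
      ∀ (x : Fin n → EuclideanSpace ℝ (Fin d)) (y : Fin n → ℝ),
        (∀ i, ‖x i‖ = 1) → 1 / (n : ℝ) * ∑ i, y i ^ 2 ≤ Y →
      ∀ (v₀ : EuclideanSpace ℝ (Fin m)) (ρ₁ : ℝ), ‖v₀‖ = 1 → 0 < ρ₁ →
      ∃ β : WeightNorm.Params d m L → ℝ,
        ∀ θ : WeightNorm.Params d m L, WeightNorm.Admissible θ →
          WeightNorm.outputVec θ ∈ Metric.closedBall v₀ ρ₁ →
          DifferentiableAt ℝ (WeightNorm.empiricalLoss φ x y) θ ∧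
          (∀ θ' : WeightNorm.Params d m L, WeightNorm.Admissible θ' →
            WeightNorm.outputVec θ' ∈ Metric.closedBall v₀ ρ₁ →
            WeightNorm.empiricalLoss φ x y θ' ≤
              WeightNorm.empiricalLoss φ x y θ
                + inner ℝ (θ' - θ) (gradient (WeightNorm.empiricalLoss φ x y) θ)
                + β θ / 2 * ‖θ' - θ‖ ^ 2) ∧
          β θ ≤ C * ((L : ℝ) ^ 4 * (1 + (L : ℝ) ^ 2 * max |φ 0| (|φ 0| ^ 2) * m) ^ 2
            * (1 + ρ₁) ^ 2
            * (1 + 1 / min (WeightNorm.minWeightNorm θ) (WeightNorm.minWeightNorm θ ^ 2))) ∧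
          (φ 0 = 0 →
            β θ ≤ C * (1 + (L : ℝ) ^ 3 * (1 + ρ₁) ^ 3 /
              (√(m : ℝ) * min (WeightNorm.minWeightNorm θ) (WeightNorm.minWeightNorm θ ^ 2)))) := by
  -- One factor 2 comes from `β θ / 2`, the other from `smoothnessScale_le_of_bias`. The absolute
  -- values keep the constant positive for all real `βφ` and `Y`.
  refine ⟨4 * (10 + 2 * (2 + |Y|) * (16 * |βφ| + 9)), by positivity, ?_⟩
  intro d m L n hm hL hn φ hφ hφ' h1 h2 x y hx hy v₀ ρ₁ hv₀ hρ₁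
  have hB : ∀ t, |deriv (deriv φ) t| ≤ |βφ| := fun t => (h2 t).trans (le_abs_self _)
  set C₀ := 10 + 2 * (2 + |Y|) * (16 * |βφ| + 9) with hC₀
  have hC₀0 : 0 ≤ C₀ := by positivity
  refine ⟨fun θ => 2 * (C₀ * WeightNorm.smoothnessScale m L (WeightNorm.activationBound φ m L) ρ₁
    (WeightNorm.minWeightNorm θ)), fun θ hθ hv => ?_⟩
  have hw₀ := WeightNorm.minWeightNorm_pos hm hL hθ
  have hw := WeightNorm.minWeightNorm_le θ
  have hA := WeightNorm.one_le_activationBound φ m L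
  have hvρ : ‖WeightNorm.outputVec θ‖ ≤ 1 + ρ₁ := by
    rw [← hv₀]
    exact norm_le_norm_add_const_of_dist_le (Metric.mem_closedBall.1 hv)
  obtain ⟨D, hD⟩ := WeightNorm.exists_abs_squareLoss_sub_sub_le hn
    (f := fun i θ => WeightNorm.predictor φ θ (x i)) (hy.trans (le_abs_self Y))
    (by positivity)
    (fun i => WeightNorm.abs_predictor_le hL hφ h1 θ (hx i))
    (fun i => WeightNorm.abs_predictor_sub_le hL hφ h1 (hx i) hw₀ hw)
    (fun i => WeightNorm.exists_abs_predictor_sub_sub_le hm hL hφ hφ' h1 hB (hx i) hw₀ hw)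
  have hE : ∀ θ', |WeightNorm.empiricalLoss φ x y θ' - WeightNorm.empiricalLoss φ x y θ
      - D (θ' - θ)| ≤ C₀ * WeightNorm.smoothnessScale m L (WeightNorm.activationBound φ m L) ρ₁
        (WeightNorm.minWeightNorm θ) * ‖θ' - θ‖ ^ 2 := fun θ' =>
    (hD θ').trans (mul_le_mul_of_nonneg_right (WeightNorm.le_smoothnessScale hm hL hA hρ₁.le hw₀
      (abs_nonneg βφ) (abs_nonneg Y) (norm_nonneg _) hvρ) (sq_nonneg _))
  refine ⟨(WeightNorm.hasFDerivAt_of_abs_sub_sub_le hE).differentiableAt, fun θ' _ _ => ?_, ?_,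
    fun hφ0 => ?_⟩
  · rw [mul_div_cancel_left₀ _ two_ne_zero]
    exact WeightNorm.le_add_inner_gradient_of_abs_sub_sub_le hE θ'
  · have h := mul_le_mul_of_nonneg_left
      (WeightNorm.smoothnessScale_le_of_bias hm hL φ hρ₁.le hw₀) hC₀0
    linarith
  · have h := mul_le_mul_of_nonneg_left
      (WeightNorm.smoothnessScale_le_of_apply_zero (m := m) (L := L) hφ0 hρ₁.le hw₀) hC₀0
    have hp : 0 ≤ C₀ * (1 + (L : ℝ) ^ 3 * (1 + ρ₁) ^ 3 / (√(m : ℝ) *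
        min (WeightNorm.minWeightNorm θ) (WeightNorm.minWeightNorm θ ^ 2))) := by
      have : 0 < min (WeightNorm.minWeightNorm θ) (WeightNorm.minWeightNorm θ ^ 2) :=
        lt_min hw₀ (by positivity)
      positivity
    linarith
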